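/- Let $\mathcal H_{\rm loc}$ be a finite-dimensional complex Hilbert space, $n\ge 0$ an integer, $\mathcal H=\mathcal H_{\rm loc}^{\otimes n}$ the Hilbert space of a lattice with sites $\Lambda=\{1,\dots,n\}$, and for $\mathcal A\subset\mathcal B(\mathcal H)$ let $\mathcal A'=\{\hat X\in\mathcal B(\mathcal H) : [\hat X,\hat Y]=0\ \forall\,\hat Y\in\mathcal A\}$ be its commutant. A quantum i.i.d. state is an operator $\hat\rho^{\otimes n}$ with $\hat\rho$ a density matrix on $\mathcal H_{\rm loc}$ (positive semidefinite, trace one), and $\mathcal B_{\rm com}$ is the set of operators on $\mathcal H$ that commute with every admissible quantum i.i.d. state. For $\sigma\in\mathfrak S_n$ let $\hat P_\sigma$ be the unitary permutation operator on $\mathcal H$, satisfying $\hat P_\sigma\hat X_i\hat P_\sigma^\dagger=\hat X_{\sigma(i)}$ for every single-site operator $\hat X$, where $\hat X_i$ is $\hat X$ acting on site $i$. For spins and bosons $\hat P_\sigma$ permutes the tensor factors. For fermions $\hat X_i$ is the fermionic (Jordan--Wigner) site operator, and $\hat P_\sigma$ maps an occupation-number basis state with $n_a$ particles on site $a$ to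 the permuted basis state times $\prod_{a<b,\ \sigma(a)>\sigma(b)}(-1)^{n_an_b}$. For particles, $\hat n$ is the number operator on $\mathcal H_{\rm loc}$ (diagonal in an occupation-number basis, with nonnegative integer eigenvalues), $\hat n_i$ is the number operator on site $i$, and $\hat N=\sum_i\hat n_i$. (1) For spin systems and massless boson systems, where every quantum i.i.d. state is admissible, $$\mathcal B_{\rm com}=\{\hat P_\sigma : \sigma\in\mathfrak S_n\}''=\operatorname{span}_{\mathbb C}\{\hat P_\sigma : \sigma\in\mathfrak S_n\}.$$ (2) For massive fermion systems and massive boson systems subject to the number-superselection rule, where the admissible quantum i.i.d. states are those commuting with $\hat N$, $$\mathcal B_{\rm com}=\big(\{\hat P_\sigma : \sigma\in\mathfrak S_n\}\cup\{\hat n_i : i\in\Lambda\}\big)''.$$ (3) For every set $\mathcal A\subset\mathcal B(\mathcal H)$ that contains the identity and is closed under Hermitian conjugation, $\mathcal A''$ is the smallest von Neumann algebra containing $\mathcal A$, and it is the algebra generated by $\mathcal A$ under scalar multiplication, addition and multiplication. -/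

import Mathlib

open scoped Matrix ComplexOrder

/-!
Lattice with `n` sites (`Fin n`).  The local Hilbert space is `ℂ^κ`, with orthonormal basis labelled
by a finite type `κ` (so `d = card κ`), and its `n`-fold tensor power is `ℂ^(Fin n → κ)`, with
orthonormal basis `|x⟩ = |x 0⟩ ⊗ ⋯ ⊗ |x (n-1)⟩`.  Operators are the matrices in these bases.
-/

namespace LatticeIID

variable {κ : Type*} [Fintype κ] [DecidableEq κ] {n : ℕ}

/-- `B(H)` for `H = (ℂ^κ)^{⊗ n}`. -/
abbrev Op (n : ℕ) (κ : Type*) := Matrix (Fin n → κ) (Fin n → κ) ℂ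

/-- A density matrix: positive semidefinite with unit trace. -/
def IsDensity (ρ : Matrix κ κ ℂ) : Prop := ρ.PosSemidef ∧ ρ.trace = 1

/-- The tensor power `X^{⊗ n}`. -/
def tensorPow (n : ℕ) (X : Matrix κ κ ℂ) : Op n κ :=
  Matrix.of fun x y => ∏ i, X (x i) (y i)

/-- The set of all i.i.d. states `ρ^{⊗ n}`. -/
def iidStates (n : ℕ) (κ : Type*) [Fintype κ] : Set (Op n κ) :=
  {R | ∃ ρ : Matrix κ κ ℂ, IsDensity ρ ∧ R = tensorPow n ρ}

/-- The operators that commute with every i.i.d. state. -/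
def bCom (n : ℕ) (κ : Type*) [Fintype κ] [DecidableEq κ] : Set (Op n κ) :=
  Set.centralizer (iidStates n κ)

/-! ### Operators for spins and bosons -/

/-- The operator `X_i` acting as `X` on the `i`-th tensor factor. -/
def siteOp (i : Fin n) (X : Matrix κ κ ℂ) : Op n κ :=
  Matrix.of fun x y => if ∀ j, j ≠ i → x j = y j then X (x i) (y i) else 0

/-- The permutation operator `P_σ`: it moves the content of site `i` to site `σ i`. -/
def permOp (σ : Equiv.Perm (Fin n)) : Op n κ :=
  Matrix.of fun x y => if x = y ∘ σ.symm then 1 else 0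

/-! ### Particle number

The basis states `a : κ` of a site are occupation-number states, and `num a` is the number of
particles in the state `a`.  (For fermions with a finite set `S` of modes on each site one
has `κ = Finset S` and `num = Finset.card`, or a subset of such states if there is a constraint.) -/

/-- The number operator `n_i` on site `i`. -/
def numberOp (num : κ → ℕ) (i : Fin n) : Op n κ :=
  siteOp i (Matrix.diagonal fun a => (num a : ℂ))

/-- The total number operator. -/
def totalNumberOp (n : ℕ) (num : κ → ℕ) : Op n κ := ∑ i : Fin n, numberOp num i

/-- The i.i.d. states allowed by the number-superselection rule: those that commute with the total
number operator.  (Such a `ρ` commutes with the number operator of one site, so for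
fermions it is even and `ρ^{⊗ n}` is also the product of the commuting site operators `ρ_i`.) -/
def physicalIidStates (n : ℕ) (num : κ → ℕ) : Set (Op n κ) :=
  {R | R ∈ iidStates n κ ∧ Commute R (totalNumberOp n num)}

/-- The operators that commute with every i.i.d. state allowed by the number-superselection rule. -/
def bComNumber (n : ℕ) (num : κ → ℕ) : Set (Op n κ) :=
  Set.centralizer (physicalIidStates n num)

/-! ### Operators for fermions

Here `|x⟩` is the state obtained from the vacuum by applying the creation operators of site `0`,
`1`, … in this order from the left. -/

/-- The fermionic operator `X_i` on site `i` (Jordan–Wigner): the part of `X` that changes the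
parity of the particle number gets the sign `(-1)^(number of particles on the sites before i)`. -/
def fermiSiteOp (num : κ → ℕ) (i : Fin n) (X : Matrix κ κ ℂ) : Op n κ :=
  Matrix.of fun x y =>
    if ∀ j, j ≠ i → x j = y j then
      (∏ k, if k < i then (-1 : ℂ) ^ num (y k) else 1) ^ (num (x i) + num (y i)) * X (x i) (y i)
    else 0

/-- The sign from reordering fermions when the content of each site `i` moves to site `σ i`:
a factor `(-1)^(n_a n_b)` for every pair of sites whose order is reversed. -/
def fermiSign (num : κ → ℕ) (σ : Equiv.Perm (Fin n)) (y : Fin n → κ) : ℂ :=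
  ∏ a, ∏ b, if a < b ∧ σ b < σ a then (-1) ^ (num (y a) * num (y b)) else 1

/-- The fermionic permutation operator `P_σ`. -/
def fermiPermOp (num : κ → ℕ) (σ : Equiv.Perm (Fin n)) : Op n κ :=
  Matrix.of fun x y => if x = y ∘ σ.symm then fermiSign num σ y else 0

/-! ### Von Neumann algebras -/

/-- A von Neumann algebra of operators on a finite-dimensional Hilbert space with a fixed
orthonormal basis: a unital `*`-subalgebra that is weakly closed, i.e. closed under entrywise
convergence. -/
def IsVonNeumannAlgebra {ι : Type*} [Fintype ι] [DecidableEq ι]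
    (M : Set (Matrix ι ι ℂ)) : Prop :=
  IsClosed M ∧ ∃ B : StarSubalgebra ℂ (Matrix ι ι ℂ), (B : Set (Matrix ι ι ℂ)) = M

set_option linter.unusedSectionVars false

/-! ### Checks: number operators are fermionic site operators, and the permutation operators are
unitaries with `P_σ X_i P_σ† = X_{σ i}` -/

theorem numberOp_eq_fermiSiteOp (num : κ → ℕ) (i : Fin n) :
    numberOp num i = fermiSiteOp num i (Matrix.diagonal fun a => (num a : ℂ)) := by
  ext x y
  simp only [numberOp, siteOp, fermiSiteOp, Matrix.of_apply]
  split_ifs with h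
  · by_cases hxy : x i = y i
    · rw [hxy, ← two_mul, pow_mul, ← Finset.prod_pow]
      rw [Finset.prod_eq_one, one_pow, one_mul]
      intro k _
      split_ifs
      · rw [← pow_mul, mul_comm, pow_mul]; simp
      · simp
    · simp [Matrix.diagonal_apply_ne _ hxy]
  · rfl

theorem siteOp_eq_fermiSiteOp (i : Fin n) (X : Matrix κ κ ℂ) :
    siteOp i X = fermiSiteOp (fun _ => 0) i X := by
  ext x y
  simp [siteOp, fermiSiteOp]

theorem permOp_eq_fermiPermOp (σ : Equiv.Perm (Fin n)) :
    permOp (κ := κ) σ = fermiPermOp (fun _ => 0) σ := by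
  ext x y
  simp [permOp, fermiPermOp, fermiSign]

theorem fermiSign_mul_self (num : κ → ℕ) (σ : Equiv.Perm (Fin n)) (y : Fin n → κ) :
    fermiSign num σ y * fermiSign num σ y = 1 := by
  rw [← sq, fermiSign, ← Finset.prod_pow]
  refine Finset.prod_eq_one fun a _ => ?_
  rw [← Finset.prod_pow]
  refine Finset.prod_eq_one fun b _ => ?_
  split_ifs
  · rw [← pow_mul, mul_comm, pow_mul]; simp
  · simp

theorem prod_prod_cross (i : Fin n) (F : Fin n → Fin n → ℂ)
    (h : ∀ a b, a ≠ i → b ≠ i → F a b = 1) (hi : F i i = 1) :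
    ∏ a, ∏ b, F a b = ∏ k, F i k * F k i := by
  rw [Finset.prod_mul_distrib, ← Finset.mul_prod_erase _ _ (Finset.mem_univ i)]
  congr 1
  rw [← Finset.mul_prod_erase _ (fun k => F k i) (Finset.mem_univ i), hi, one_mul]
  refine Finset.prod_congr rfl fun a ha => ?_
  exact Finset.prod_eq_single i (fun b _ hb => h a b (Finset.ne_of_mem_erase ha) hb) (by simp)

theorem fermiSign_mul_fermiSign (num : κ → ℕ) (σ : Equiv.Perm (Fin n)) (i : Fin n)
    (w y : Fin n → κ) (h : ∀ j, j ≠ i → w j = y j) :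
    fermiSign num σ w * fermiSign num σ y *
      (∏ k, if k < i then (-1 : ℂ) ^ num (y k) else 1) ^ (num (w i) + num (y i)) =
    (∏ k, if k < σ i then (-1 : ℂ) ^ num (y (σ.symm k)) else 1) ^ (num (w i) + num (y i)) := by
  have e : ∀ m : ℕ, ((-1 : ℂ) ^ m) * (-1) ^ m = 1 := fun m => by rw [← mul_pow]; simp
  have e2 : ∏ k, (if k < σ i then (-1 : ℂ) ^ num (y (σ.symm k)) else 1) =
      ∏ k, if σ k < σ i then (-1 : ℂ) ^ num (y k) else 1 := by
    rw [← Equiv.prod_comp σ]; simp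
  rw [e2]
  simp only [fermiSign, ← Finset.prod_mul_distrib]
  rw [prod_prod_cross i]
  · rw [← Finset.prod_pow, ← Finset.prod_pow, ← Finset.prod_mul_distrib]
    refine Finset.prod_congr rfl fun k _ => ?_
    by_cases hk : k = i
    · subst hk; simp
    · rw [h k hk]
      have hs : σ k ≠ σ i := fun hh => hk (σ.injective hh)
      have key : (-1 : ℂ) ^ (num (w i) * num (y k)) * (-1) ^ (num (y i) * num (y k)) =
          ((-1) ^ num (y k)) ^ (num (w i) + num (y i)) := by
        rw [← pow_add, ← pow_mul]; congr 1; ring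
      have key2 : (-1 : ℂ) ^ (num (y k) * num (w i)) * (-1) ^ (num (y k) * num (y i)) =
          ((-1) ^ num (y k)) ^ (num (w i) + num (y i)) := by
        rw [← pow_add, ← pow_mul]; congr 1; ring
      have sqk : (((-1 : ℂ) ^ num (y k)) ^ (num (w i) + num (y i))) *
          ((-1) ^ num (y k)) ^ (num (w i) + num (y i)) = 1 := by
        rw [← mul_pow, e, one_pow]
      rcases lt_or_gt_of_ne hk with h1 | h1 <;> rcases lt_or_gt_of_ne hs with h2 | h2 <;>
        simp [h1, h2, not_lt_of_gt h1, not_lt_of_gt h2, key, key2, sqk]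
  · intro a b ha hb
    rw [h a ha, h b hb]
    split_ifs
    · exact e _
    · simp
  · simp

theorem fermiPermOp_mul_site (num : κ → ℕ) (σ : Equiv.Perm (Fin n)) (i : Fin n)
    (X : Matrix κ κ ℂ) :
    fermiPermOp num σ * fermiSiteOp num i X = fermiSiteOp num (σ i) X * fermiPermOp num σ := by
  ext x y
  obtain ⟨w, rfl⟩ : ∃ w : Fin n → κ, x = w ∘ σ.symm :=
    ⟨x ∘ σ, by ext; simp⟩
  have c : ∀ u v : Fin n → κ, u ∘ σ.symm = v ∘ σ.symm ↔ u = v := fun u v =>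
    σ.symm.surjective.right_cancellable
  simp only [Matrix.mul_apply, fermiPermOp, fermiSiteOp, Matrix.of_apply, c]
  rw [Finset.sum_eq_single w (fun z _ hz => by rw [if_neg (Ne.symm hz), zero_mul]) (by simp),
    Finset.sum_eq_single (y ∘ σ.symm) (fun z _ hz => by rw [if_neg hz, mul_zero]) (by simp),
    if_pos rfl, if_pos rfl]
  have hc : (∀ j, j ≠ σ i → (w ∘ σ.symm) j = (y ∘ σ.symm) j) ↔ ∀ j, j ≠ i → w j = y j := by
    constructor
    · intro h j hj
      simpa using h (σ j) (fun hh => hj (σ.injective hh))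
    · intro h j hj
      exact h _ (fun hh => hj (by rw [← hh]; simp))
  simp only [hc]
  split_ifs with h
  · have := fermiSign_mul_fermiSign num σ i w y h
    have h2 := fermiSign_mul_self num σ y
    simp only [Function.comp_apply, Equiv.symm_apply_apply]
    rw [← this]
    linear_combination (-(fermiSign num σ w * (∏ k, if k < i then (-1 : ℂ) ^ num (y k) else 1) ^
      (num (w i) + num (y i)) * X (w i) (y i))) * h2
  · simp

theorem fermiPermOp_unitary (num : κ → ℕ) (σ : Equiv.Perm (Fin n)) :
    fermiPermOp num σ ∈ Matrix.unitaryGroup (Fin n → κ) ℂ := by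
  rw [Matrix.mem_unitaryGroup_iff']
  ext x y
  have hs : star (fermiSign num σ x) = fermiSign num σ x := by
    simp only [fermiSign, star_prod]
    refine Finset.prod_congr rfl fun a _ => Finset.prod_congr rfl fun b _ => ?_
    split_ifs <;> simp
  have c : ∀ u v : Fin n → κ, u ∘ σ.symm = v ∘ σ.symm ↔ u = v := fun u v =>
    σ.symm.surjective.right_cancellable
  simp only [Matrix.mul_apply, Matrix.star_apply, fermiPermOp, Matrix.of_apply]
  simp only [mul_ite, mul_zero, Finset.sum_ite_eq', Finset.mem_univ, if_true, c, Matrix.one_apply]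
  by_cases hxy : x = y
  · subst hxy; simp [hs, fermiSign_mul_self]
  · simp [hxy, Ne.symm hxy]

theorem fermiPermOp_conj_site (num : κ → ℕ) (σ : Equiv.Perm (Fin n)) (i : Fin n)
    (X : Matrix κ κ ℂ) :
    fermiPermOp num σ * fermiSiteOp num i X * (fermiPermOp num σ)ᴴ = fermiSiteOp num (σ i) X := by
  rw [fermiPermOp_mul_site, mul_assoc, ← Matrix.star_eq_conjTranspose,
    Matrix.mem_unitaryGroup_iff.1 (fermiPermOp_unitary num σ), mul_one]

theorem permOp_unitary (σ : Equiv.Perm (Fin n)) :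
    permOp σ ∈ Matrix.unitaryGroup (Fin n → κ) ℂ := by
  rw [permOp_eq_fermiPermOp]; exact fermiPermOp_unitary _ σ

theorem permOp_conj_site (σ : Equiv.Perm (Fin n)) (i : Fin n) (X : Matrix κ κ ℂ) :
    permOp σ * siteOp i X * (permOp σ)ᴴ = siteOp (σ i) X := by
  simp only [permOp_eq_fermiPermOp, siteOp_eq_fermiSiteOp, fermiPermOp_conj_site]

end LatticeIID

open scoped Matrix ComplexOrder

/-! All cases compare two commutants through the set `symmOps`: permutation-invariant operators
preserving the particle number of each site. It is the commutant of the permutation and number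
operators, also for fermions, because `fermiSign` depends only on the site numbers and cancels on
such operators (`fermiPermOp_commute_iff`).

Admissible i.i.d. states lie in `symmOps` (`physicalIidStates_subset_symmOps`) and, for `n ≠ 0`,
span it (`symmOps_subset_span_physicalIidStates`): an invariant operator is a combination of
symmetrized products of matrix units, polarization writes those units through positive matrices, and
Ryser's formula writes symmetrized products through tensor powers of sums. Hence both sets have the
same commutant. Spins are the case `num = 0`.

The double commutant theorem then identifies bicommutants with generated algebras, and the
permutation operators form a group, so theirs is a span. -/

namespace LatticeIID

/-! ### The double commutant theorem for matrix algebras -/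

section DoubleCommutant

variable {ι : Type*} [Fintype ι]

/-- Orthogonal projection onto a space of matrices, for the Frobenius inner product. -/
theorem exists_frobenius_projection (K : Submodule ℂ (Matrix ι ι ℂ)) :
    ∃ p : Matrix ι ι ℂ →ₗ[ℂ] Matrix ι ι ℂ, (∀ X, p X ∈ K) ∧ (∀ X ∈ K, p X = X) ∧
      ∀ X, ∀ Y ∈ K, (Yᴴ * (X - p X)).trace = 0 := by
  let e : Matrix ι ι ℂ ≃ₗ[ℂ] EuclideanSpace ℂ (ι × ι) :=
    (Matrix.ofLinearEquiv ℂ).symm ≪≫ₗ (LinearEquiv.curry ℂ ℂ ι ι).symm ≪≫ₗ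
      (WithLp.linearEquiv 2 ℂ (ι × ι → ℂ)).symm
  have he : ∀ X Y : Matrix ι ι ℂ, inner ℂ (e Y) (e X) = (Yᴴ * X).trace := by
    intro X Y
    simp only [e, PiLp.inner_apply, Matrix.trace, Matrix.diag, Matrix.mul_apply,
      Matrix.conjTranspose_apply]
    rw [Fintype.sum_prod_type, Finset.sum_comm]
    refine Finset.sum_congr rfl fun i _ => Finset.sum_congr rfl fun j _ => ?_
    exact mul_comm _ _
  let L : Submodule ℂ (EuclideanSpace ℂ (ι × ι)) := K.map e.toLinearMap
  refine ⟨e.symm.toLinearMap ∘ₗ L.starProjection.toLinearMap ∘ₗ e.toLinearMap, ?_, ?_, ?_⟩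
  · intro X
    obtain ⟨Y, hY, h⟩ : L.starProjection (e X) ∈ K.map e.toLinearMap :=
      L.starProjection_apply_mem (e X)
    have : e.symm (L.starProjection (e X)) = Y := by rw [← h]; simp
    simpa [this] using hY
  · intro X hX
    have : L.starProjection (e X) = e X :=
      Submodule.starProjection_eq_self_iff.2 (Submodule.mem_map_of_mem hX)
    simp [this]
  · intro X Y hY
    rw [← he]
    have h1 : e Y ∈ L := Submodule.mem_map_of_mem hY
    have := L.starProjection_inner_eq_zero (e X) (e Y) h1
    rw [← inner_conj_symm]
    simpa using congrArg (starRingEnd ℂ) this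

variable [DecidableEq ι]

/-- The blocks `C_{kl}` of a linear map `p` on matrices, seen as acting on tuples of columns. -/
def columnBlock (p : Matrix ι ι ℂ →ₗ[ℂ] Matrix ι ι ℂ) (k l : ι) : Matrix ι ι ℂ :=
  Matrix.of fun i j => p (Matrix.single j l 1) i k

/-- A matrix is a tuple of columns, on which left multiplication by `T` is block diagonal with equal
blocks `T`; commuting with `p` can be tested block by block. This is the amplification in von
Neumann's argument. -/
theorem commute_columnBlock_iff (p : Matrix ι ι ℂ →ₗ[ℂ] Matrix ι ι ℂ) (T : Matrix ι ι ℂ) :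
    (∀ k l, T * columnBlock p k l = columnBlock p k l * T) ↔ ∀ X, p (T * X) = T * p X := by
  have key : ∀ i j k l, (T * columnBlock p k l) i j = (T * p (Matrix.single j l 1)) i k := by
    intro i j k l
    simp [Matrix.mul_apply, columnBlock]
  have key2 : ∀ i j k l, (columnBlock p k l * T) i j = p (T * Matrix.single j l 1) i k := by
    intro i j k l
    have : T * Matrix.single j l 1 = ∑ m, T m j • Matrix.single m l (1 : ℂ) := by
      ext a b
      simp [Matrix.mul_apply, Matrix.single_apply, Matrix.sum_apply, ite_and]
    rw [this]
    simp only [map_sum, map_smul, Matrix.sum_apply, Matrix.smul_apply, Matrix.mul_apply,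
      columnBlock, Matrix.of_apply, smul_eq_mul, mul_comm]
  constructor
  · intro h X
    have h1 : ∀ j l, p (T * Matrix.single j l 1) = T * p (Matrix.single j l 1) := by
      intro j l
      ext i k
      rw [← key2, ← key, h]
    rw [Matrix.matrix_eq_sum_single X]
    simp only [Finset.mul_sum, map_sum]
    refine Finset.sum_congr rfl fun j _ => Finset.sum_congr rfl fun l _ => ?_
    have : Matrix.single j l (X j l) = X j l • Matrix.single j l (1 : ℂ) := by simp
    rw [this, Matrix.mul_smul, map_smul, map_smul, Matrix.mul_smul, h1]
  · intro h k l
    ext i j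
    rw [key, key2, h]

/-- The double commutant theorem in finite dimension. -/
theorem centralizer_centralizer_subset (B : Subalgebra ℂ (Matrix ι ι ℂ))
    (hB : ∀ X ∈ B, Xᴴ ∈ B) :
    Set.centralizer (Set.centralizer (B : Set (Matrix ι ι ℂ))) ⊆ B := by
  intro T hT
  obtain ⟨p, hp1, hp2, hp3⟩ := exists_frobenius_projection (Subalgebra.toSubmodule B)
  have hcomm : ∀ b ∈ B, ∀ X, p (b * X) = b * p X := by
    intro b hb X
    rw [← sub_eq_zero]
    -- `D` lies in `B`, is orthogonal to `b * X - p (b * X)`, and is orthogonal to `b * (X - p X)`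
    -- because `bᴴ * D` is in `B`; so `D` is orthogonal to itself.
    set D := p (b * X) - b * p X with hD
    have hDB : D ∈ Subalgebra.toSubmodule B :=
      Submodule.sub_mem _ (hp1 _) (B.mul_mem hb (hp1 X))
    rw [← Matrix.trace_conjTranspose_mul_self_eq_zero_iff]
    have h1 := hp3 (b * X) D hDB
    have h2 := hp3 X (bᴴ * D) (B.mul_mem (hB b hb) hDB)
    rw [Matrix.conjTranspose_mul, Matrix.conjTranspose_conjTranspose, Matrix.mul_assoc] at h2
    have : Dᴴ * D = Dᴴ * (b * (X - p X)) - Dᴴ * (b * X - p (b * X)) := by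
      rw [← Matrix.mul_sub]
      congr 1
      rw [hD, Matrix.mul_sub]
      abel
    rw [this, Matrix.trace_sub, h1, h2, sub_zero]
  have hC : ∀ k l, columnBlock p k l ∈ Set.centralizer (B : Set (Matrix ι ι ℂ)) :=
    fun k l b hb => (commute_columnBlock_iff p b).2 (hcomm b hb) k l
  -- Evaluating at `1 ∈ B` gives `p T = T * p 1 = T`, so `T` is in the range of `p`.
  have hT2 := (commute_columnBlock_iff p T).1 (fun k l => (hT _ (hC k l)).symm) 1
  rw [mul_one, hp2 1 B.one_mem, mul_one] at hT2
  rw [← hT2]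
  exact hp1 T

theorem conjTranspose_mem_adjoin {A : Set (Matrix ι ι ℂ)} (hA : ∀ X ∈ A, Xᴴ ∈ A)
    {X : Matrix ι ι ℂ} (hX : X ∈ Algebra.adjoin ℂ A) : Xᴴ ∈ Algebra.adjoin ℂ A := by
  induction hX using Algebra.adjoin_induction with
  | mem x hx => exact Algebra.subset_adjoin (hA x hx)
  | algebraMap r =>
    have : (algebraMap ℂ (Matrix ι ι ℂ) r)ᴴ = algebraMap ℂ (Matrix ι ι ℂ) (star r) :=
      (algebraMap_star_comm r).symm
    rw [this]
    exact Subalgebra.algebraMap_mem _ _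
  | add x y _ _ hx hy => rw [Matrix.conjTranspose_add]; exact add_mem hx hy
  | mul x y _ _ hx hy => rw [Matrix.conjTranspose_mul]; exact mul_mem hy hx

theorem centralizer_centralizer_eq_adjoin {A : Set (Matrix ι ι ℂ)} (hA : ∀ X ∈ A, Xᴴ ∈ A) :
    Set.centralizer (Set.centralizer A) = (Algebra.adjoin ℂ A : Set (Matrix ι ι ℂ)) := by
  refine Set.Subset.antisymm ?_ (Algebra.adjoin_le_centralizer_centralizer ℂ A)
  exact (Set.centralizer_subset (Set.centralizer_subset Algebra.subset_adjoin)).trans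
    (centralizer_centralizer_subset _ fun _ => conjTranspose_mem_adjoin hA)

theorem isLeast_centralizer_centralizer {A : Set (Matrix ι ι ℂ)} (hA : ∀ X ∈ A, Xᴴ ∈ A) :
    IsLeast {M | IsVonNeumannAlgebra M ∧ A ⊆ M} (Set.centralizer (Set.centralizer A)) := by
  refine ⟨⟨⟨Set.isClosed_centralizer _, ?_⟩, Set.subset_centralizer_centralizer⟩, ?_⟩
  · refine ⟨{ Algebra.adjoin ℂ A with
      star_mem' := fun hX => conjTranspose_mem_adjoin hA hX }, ?_⟩
    exact (centralizer_centralizer_eq_adjoin hA).symm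
  · rintro M ⟨⟨-, B, rfl⟩, hAB⟩
    rw [centralizer_centralizer_eq_adjoin hA]
    exact Algebra.adjoin_le (S := B.toSubalgebra) hAB

end DoubleCommutant

/-! ### Symmetrized products as combinations of tensor powers -/

section Polarization

/-- Ryser's formula for the permanent. -/
theorem sum_perm_prod_eq {ι R : Type*} [Fintype ι] [DecidableEq ι] [CommRing R]
    (a : ι → ι → R) :
    ∑ σ : Equiv.Perm ι, ∏ i, a (σ i) i =
      ∑ S : Finset ι, (-1) ^ S.card * ∏ i, ∑ k ∈ Sᶜ, a k i := by
  have h1 : ∀ S : Finset ι, (-1) ^ S.card * ∏ i, ∑ k ∈ Sᶜ, a k i =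
      ∑ f : ι → ι, if S ⊆ (Finset.univ.image f)ᶜ then (-1) ^ S.card * ∏ i, a (f i) i else 0 := by
    intro S
    rw [Finset.prod_univ_sum, Finset.mul_sum, ← Finset.sum_filter]
    refine Finset.sum_congr ?_ fun _ _ => rfl
    ext f
    simp only [Fintype.mem_piFinset, Finset.mem_compl, Finset.mem_filter, Finset.mem_univ,
      true_and, Finset.subset_iff, Finset.mem_image, not_exists]
    exact ⟨fun h x hx i hi => h i (hi ▸ hx), fun h i hi => h hi i rfl⟩
  -- Inclusion–exclusion: the alternating sum over the sets avoided by `f` vanishes unless `f` is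
  -- surjective, hence bijective.
  have h2 : ∀ f : ι → ι,
      ∑ S : Finset ι, (if S ⊆ (Finset.univ.image f)ᶜ then (-1 : R) ^ S.card * ∏ i, a (f i) i
        else 0) = if Function.Bijective f then ∏ i, a (f i) i else 0 := by
    intro f
    have e : ∑ S : Finset ι, (if S ⊆ (Finset.univ.image f)ᶜ then
        (-1 : R) ^ S.card * ∏ i, a (f i) i else 0) =
        ((∑ S ∈ ((Finset.univ.image f)ᶜ).powerset, (-1 : ℤ) ^ S.card : ℤ) : R) *
          ∏ i, a (f i) i := by
      rw [← Finset.sum_filter]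
      push_cast
      rw [Finset.sum_mul]
      exact Finset.sum_congr (by ext; simp) fun _ _ => rfl
    rw [e, Finset.sum_powerset_neg_one_pow_card]
    have : (Finset.univ.image f)ᶜ = ∅ ↔ Function.Bijective f := by
      rw [Finset.compl_eq_empty_iff, ← Finite.surjective_iff_bijective, Finset.eq_univ_iff_forall]
      simp [Function.Surjective]
    simp only [this]
    split_ifs <;> simp
  simp only [h1]
  rw [Finset.sum_comm]
  simp only [h2]
  rw [← Finset.sum_filter]
  symm
  exact Finset.sum_bij (fun p h => Equiv.ofBijective p (Finset.mem_filter.1 h).2)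
    (fun _ _ => Finset.mem_univ _)
    (fun _ _ _ _ h => by injection h)
    (fun b _ => ⟨b, Finset.mem_filter.2 ⟨Finset.mem_univ _, b.bijective⟩,
      DFunLike.coe_injective rfl⟩)
    (fun _ _ => rfl)

variable {κ : Type*} {n : ℕ}

/-- The symmetrized tensor product `∑_σ M_{σ 0} ⊗ ⋯ ⊗ M_{σ (n-1)}`. -/
def symmProd (n : ℕ) (κ : Type*) :
    MultilinearMap ℂ (fun _ : Fin n => Matrix κ κ ℂ) (Op n κ) :=
  (Matrix.ofLinearEquiv ℂ).toLinearMap.compMultilinearMap <|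
    MultilinearMap.pi fun x => MultilinearMap.pi fun y => ∑ σ : Equiv.Perm (Fin n),
      (MultilinearMap.mkPiAlgebra ℂ (Fin n) ℂ).compLinearMap
        fun k => Matrix.entryLinearMap ℂ ℂ (x (σ k)) (y (σ k))

theorem symmProd_apply (M : Fin n → Matrix κ κ ℂ) (x y : Fin n → κ) :
    symmProd n κ M x y = ∑ σ : Equiv.Perm (Fin n), ∏ k, M k (x (σ k)) (y (σ k)) := by
  simp [symmProd]

/-- Each entry is a permanent. Ryser's formula is the suitable polarization because it needs only
sums of the `M k`, which stay inside a cone of positive matrices. -/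
theorem symmProd_eq_sum_tensorPow (M : Fin n → Matrix κ κ ℂ) :
    symmProd n κ M = ∑ S : Finset (Fin n), (-1 : ℂ) ^ S.card • tensorPow n (∑ k ∈ Sᶜ, M k) := by
  ext x y
  rw [symmProd_apply, Matrix.sum_apply, ← Equiv.sum_comp (Equiv.inv (Equiv.Perm (Fin n)))]
  have := sum_perm_prod_eq fun k i => M k (x i) (y i)
  simp only [tensorPow, Matrix.smul_apply, Matrix.of_apply, Matrix.sum_apply, smul_eq_mul]
  rw [← this]
  refine Finset.sum_congr rfl fun σ _ => ?_
  rw [← Equiv.prod_comp σ]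
  simp

/-- With all factors in `P`, Ryser's formula applies; multilinearity then releases the factors from
`P` to its span one slot at a time. -/
theorem symmProd_mem {P : Set (Matrix κ κ ℂ)} (h0 : 0 ∈ P) (hadd : ∀ X ∈ P, ∀ Y ∈ P, X + Y ∈ P)
    {W : Submodule ℂ (Op n κ)} (hW : ∀ X ∈ P, tensorPow n X ∈ W) (M : Fin n → Matrix κ κ ℂ)
    (hM : ∀ i, M i ∈ Submodule.span ℂ P) : symmProd n κ M ∈ W := by
  suffices H : ∀ s : Finset (Fin n), ∀ M : Fin n → Matrix κ κ ℂ,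
      (∀ i ∈ s, M i ∈ Submodule.span ℂ P) → (∀ i ∉ s, M i ∈ P) → symmProd n κ M ∈ W from
    H Finset.univ M (fun i _ => hM i) (by simp)
  intro s
  induction s using Finset.induction_on with
  | empty =>
    intro M _ hM
    rw [symmProd_eq_sum_tensorPow]
    refine Submodule.sum_mem _ fun S _ => Submodule.smul_mem _ _ (hW _ ?_)
    exact Finset.sum_induction _ (· ∈ P) (fun X Y hX hY => hadd X hX Y hY) h0
      fun k _ => hM k (by simp)
  | insert a s ha ih =>
    intro M h1 h2
    have key : ∀ X ∈ Submodule.span ℂ P, symmProd n κ (Function.update M a X) ∈ W := by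
      intro X hX
      induction hX using Submodule.span_induction with
      | mem X hX =>
        refine ih _ (fun i hi => ?_) fun i hi => ?_
        · have hia : i ≠ a := fun h => ha (h ▸ hi)
          rw [Function.update_of_ne hia]
          exact h1 i (Finset.mem_insert_of_mem hi)
        · by_cases hia : i = a
          · subst hia; simpa using hX
          · rw [Function.update_of_ne hia]
            exact h2 i (by simp [hia, hi])
      | zero => rw [MultilinearMap.map_update_zero]; exact W.zero_mem
      | add X Y _ _ hX hY => rw [MultilinearMap.map_update_add]; exact W.add_mem hX hY
      | smul c X _ hX => rw [MultilinearMap.map_update_smul]; exact W.smul_mem c hX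
    simpa using key (M a) (h1 a (Finset.mem_insert_self a s))

variable [Fintype κ] [DecidableEq κ]

/-- Each permutation contributes the matrix-unit expansion of a permuted copy of `X`, which is `X`
by invariance. -/
theorem sum_smul_symmProd_single (X : Op n κ)
    (hX : ∀ (σ : Equiv.Perm (Fin n)) x y, X (x ∘ σ) (y ∘ σ) = X x y) :
    ∑ x, ∑ y, X x y • symmProd n κ (fun k => Matrix.single (x k) (y k) 1) =
      (n.factorial : ℂ) • X := by
  ext u v
  have h : ∀ (x y : Fin n → κ) (σ : Equiv.Perm (Fin n)),
      ∏ k, (Matrix.single (x k) (y k) 1 : Matrix κ κ ℂ) (u (σ k)) (v (σ k)) =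
        if x = u ∘ σ ∧ y = v ∘ σ then 1 else 0 := by
    intro x y σ
    simp only [Matrix.single_apply]
    rw [Fintype.prod_ite_zero]
    simp [funext_iff, forall_and]
  simp only [Matrix.sum_apply, Matrix.smul_apply, symmProd_apply, h, smul_eq_mul, Finset.mul_sum,
    mul_ite, mul_one, mul_zero]
  have h3 : ∀ x, ∑ y, ∑ σ : Equiv.Perm (Fin n), (if x = u ∘ σ ∧ y = v ∘ σ then X x y else 0) =
      ∑ σ : Equiv.Perm (Fin n), if x = u ∘ σ then X x (v ∘ σ) else 0 := by
    intro x
    rw [Finset.sum_comm]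
    refine Finset.sum_congr rfl fun σ _ => ?_
    simp [ite_and]
  simp only [h3]
  rw [Finset.sum_comm]
  simp [hX, Fintype.card_perm]

theorem mem_of_forall_symmProd_single_mem {W : Submodule ℂ (Op n κ)} (X : Op n κ)
    (hX : ∀ (σ : Equiv.Perm (Fin n)) x y, X (x ∘ σ) (y ∘ σ) = X x y)
    (hW : ∀ x y, X x y ≠ 0 → symmProd n κ (fun k => Matrix.single (x k) (y k) 1) ∈ W) :
    X ∈ W := by
  have hn : (n.factorial : ℂ) ≠ 0 := by exact_mod_cast n.factorial_ne_zero
  rw [← Submodule.smul_mem_iff _ hn, ← sum_smul_symmProd_single X hX]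
  refine Submodule.sum_mem _ fun x _ => Submodule.sum_mem _ fun y _ => ?_
  by_cases h : X x y = 0
  · rw [h, zero_smul]; exact W.zero_mem
  · exact W.smul_mem _ (hW x y h)

end Polarization

/-! ### The common commutant, and its span by i.i.d. states -/

section Commutants

set_option linter.unusedSectionVars false

variable {κ : Type*} [Fintype κ] [DecidableEq κ] {n : ℕ}

/-- The permutation-invariant operators that preserve the particle number of every site. -/
def symmOps (n : ℕ) (num : κ → ℕ) : Set (Op n κ) :=
  {X | (∀ (σ : Equiv.Perm (Fin n)) x y, X (x ∘ σ) (y ∘ σ) = X x y) ∧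
    ∀ x y, X x y ≠ 0 → ∀ i, num (x i) = num (y i)}

theorem numberOp_eq_diagonal (num : κ → ℕ) (i : Fin n) :
    numberOp num i = Matrix.diagonal fun x : Fin n → κ => (num (x i) : ℂ) := by
  ext x y
  by_cases hxy : x = y
  · subst hxy; simp [numberOp, siteOp]
  · rw [Matrix.diagonal_apply_ne _ hxy]
    simp only [numberOp, siteOp, Matrix.of_apply]
    split_ifs with h
    · refine Matrix.diagonal_apply_ne _ fun hi => hxy (funext fun j => ?_)
      by_cases hj : j = i
      · rw [hj, hi]
      · exact h j hj
    · rfl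

theorem totalNumberOp_eq_diagonal (num : κ → ℕ) :
    totalNumberOp n num = Matrix.diagonal fun x : Fin n → κ => ((∑ i, num (x i) : ℕ) : ℂ) := by
  simp only [totalNumberOp, numberOp_eq_diagonal]
  ext x y
  by_cases hxy : x = y
  · subst hxy; simp [Matrix.sum_apply]
  · simp [Matrix.sum_apply, Matrix.diagonal_apply_ne _ hxy]

theorem commute_diagonal_iff {ι : Type*} [Fintype ι] [DecidableEq ι] (X : Matrix ι ι ℂ)
    (d : ι → ℕ) :
    Matrix.diagonal (fun i => (d i : ℂ)) * X = X * Matrix.diagonal (fun i => (d i : ℂ)) ↔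
      ∀ x y, X x y ≠ 0 → d x = d y := by
  rw [← Matrix.ext_iff]
  refine forall_congr' fun x => forall_congr' fun y => ?_
  rw [Matrix.diagonal_mul, Matrix.mul_diagonal, mul_comm, mul_eq_mul_left_iff, Nat.cast_inj]
  tauto

/-- Where `X x y ≠ 0`, the configurations `x` and `y` have equal site numbers, so the reordering
signs on the two sides agree and, being nonzero, cancel. -/
theorem fermiPermOp_commute_iff (num : κ → ℕ) (X : Op n κ)
    (hX : ∀ x y, X x y ≠ 0 → ∀ i, num (x i) = num (y i)) (σ : Equiv.Perm (Fin n)) :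
    fermiPermOp num σ * X = X * fermiPermOp num σ ↔ ∀ x y, X (x ∘ σ) (y ∘ σ) = X x y := by
  have c : ∀ u v : Fin n → κ, u ∘ σ.symm = v ∘ σ.symm ↔ u = v := fun u v =>
    σ.symm.surjective.right_cancellable
  have hl : ∀ x y, (fermiPermOp num σ * X) x y = fermiSign num σ (x ∘ σ) * X (x ∘ σ) y := by
    intro x y
    obtain ⟨w, rfl⟩ : ∃ w : Fin n → κ, x = w ∘ σ.symm := ⟨x ∘ σ, by ext; simp⟩
    have hw : (w ∘ σ.symm) ∘ σ = w := by ext; simp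
    simp only [Matrix.mul_apply, fermiPermOp, Matrix.of_apply, c, hw]
    rw [Finset.sum_eq_single w (fun z _ hz => by rw [if_neg (Ne.symm hz), zero_mul]) (by simp),
      if_pos rfl]
  have hr : ∀ x y, (X * fermiPermOp num σ) x y = X x (y ∘ σ.symm) * fermiSign num σ y := by
    intro x y
    simp only [Matrix.mul_apply, fermiPermOp, Matrix.of_apply]
    rw [Finset.sum_eq_single (y ∘ σ.symm) (fun z _ hz => by rw [if_neg hz, mul_zero]) (by simp),
      if_pos rfl]
  have hs : ∀ x y, X x y ≠ 0 → fermiSign num σ (x ∘ σ) = fermiSign num σ (y ∘ σ) := by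
    intro x y h
    simp only [fermiSign, Function.comp_apply, hX x y h]
  have hs' : ∀ x y, X (x ∘ σ) (y ∘ σ) ≠ 0 →
      fermiSign num σ (x ∘ σ) = fermiSign num σ (y ∘ σ) := by
    intro x y h
    have := hX _ _ h
    simp only [Function.comp_apply] at this
    simp only [fermiSign, Function.comp_apply, this]
  have hne : ∀ y, fermiSign num σ y ≠ 0 := fun y h => by
    simpa [h] using fermiSign_mul_self num σ y
  have hy : ∀ y : Fin n → κ, (y ∘ σ) ∘ σ.symm = y := fun y => by ext; simp
  constructor
  · intro h x y
    have h1 := congrFun (congrFun h x) (y ∘ σ)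
    rw [hl, hr, hy] at h1
    by_cases h0 : X x y = 0
    · rw [h0, zero_mul, mul_eq_zero] at h1
      rw [h0]
      exact h1.resolve_left (hne _)
    · rw [hs x y h0, mul_comm] at h1
      exact mul_right_cancel₀ (hne _) h1
  · intro h
    ext x z
    obtain ⟨y, rfl⟩ : ∃ y : Fin n → κ, z = y ∘ σ := ⟨z ∘ σ.symm, by ext; simp⟩
    rw [hl, hr, hy]
    by_cases h0 : X (x ∘ σ) (y ∘ σ) = 0
    · rw [← h x y, h0, zero_mul, mul_zero]
    · rw [hs' x y h0, h x y, mul_comm]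

theorem mem_centralizer_numberOp_iff (num : κ → ℕ) (X : Op n κ) :
    X ∈ Set.centralizer (Set.range (numberOp (n := n) num)) ↔
      ∀ x y, X x y ≠ 0 → ∀ i, num (x i) = num (y i) := by
  simp only [Set.mem_centralizer_iff, Set.forall_mem_range, numberOp_eq_diagonal,
    commute_diagonal_iff X fun x => num (x _)]
  exact ⟨fun h x y hxy i => h i x y hxy, fun h i x y hxy => h x y hxy i⟩

theorem centralizer_fermiPermOp_union_numberOp (num : κ → ℕ) :
    Set.centralizer (Set.range (fermiPermOp (n := n) num) ∪ Set.range (numberOp num)) =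
      symmOps n num := by
  ext X
  rw [Set.centralizer_union, Set.mem_inter_iff, mem_centralizer_numberOp_iff]
  refine and_congr_left fun hX => ?_
  rw [Set.mem_centralizer_iff, Set.forall_mem_range]
  exact forall_congr' fun σ => fermiPermOp_commute_iff num X hX σ

theorem centralizer_permOp :
    Set.centralizer (Set.range (permOp (κ := κ) (n := n))) = symmOps n fun _ => 0 := by
  ext X
  rw [Set.mem_centralizer_iff, Set.forall_mem_range]
  simp only [symmOps, Set.mem_ofPred_eq, implies_true, and_true]
  refine forall_congr' fun σ => ?_
  rw [permOp_eq_fermiPermOp]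
  exact fermiPermOp_commute_iff _ X (fun _ _ _ _ => rfl) σ

theorem centralizer_permOp_union_numberOp (num : κ → ℕ) :
    Set.centralizer (Set.range (permOp (κ := κ) (n := n)) ∪ Set.range (numberOp num)) =
      symmOps n num := by
  ext X
  rw [Set.centralizer_union, Set.mem_inter_iff, mem_centralizer_numberOp_iff, centralizer_permOp]
  simp [symmOps]

/-- Positive semidefinite one-site operators that preserve the particle number. -/
def posNumberOps (num : κ → ℕ) : Set (Matrix κ κ ℂ) :=
  {ρ | ρ.PosSemidef ∧ ∀ a b, ρ a b ≠ 0 → num a = num b}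

theorem single_mem_span_posNumberOps (num : κ → ℕ) {a b : κ} (hab : num a = num b) :
    Matrix.single a b (1 : ℂ) ∈ Submodule.span ℂ (posNumberOps num) := by
  let v : ℂ → κ → ℂ := fun c => Pi.single a 1 + c • Pi.single b 1
  have hv : ∀ c, Matrix.vecMulVec (v c) (star (v c)) ∈
      Submodule.span ℂ (posNumberOps num) := by
    intro c
    refine Submodule.subset_span ⟨Matrix.posSemidef_vecMulVec_self_star _, fun x y h => ?_⟩
    have hz : ∀ z, v c z ≠ 0 → num z = num a := by
      intro z hz
      by_cases h1 : z = a
      · rw [h1]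
      by_cases h2 : z = b
      · rw [h2, hab]
      simp [v, h1, h2] at hz
    rw [Matrix.vecMulVec_apply, mul_ne_zero_iff] at h
    rw [hz x h.1, hz y (by simpa using h.2)]
  -- Polarization over the fourth roots of unity `c`: the weight `c` turns the coefficient of
  -- `|a⟩⟨b|` into `c * star c = 1`, while the other terms carry `c` or `c ^ 2` and sum to zero.
  have key : Matrix.single a b (1 : ℂ) = (4 : ℂ)⁻¹ •
      (Matrix.vecMulVec (v 1) (star (v 1)) + (-1 : ℂ) • Matrix.vecMulVec (v (-1)) (star (v (-1))) +
        Complex.I • Matrix.vecMulVec (v Complex.I) (star (v Complex.I)) +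
        (-Complex.I) • Matrix.vecMulVec (v (-Complex.I)) (star (v (-Complex.I)))) := by
    ext x y
    have hs : ∀ (i j : κ), star ((Pi.single i 1 : κ → ℂ) j) = (Pi.single i 1 : κ → ℂ) j := by
      intro i j
      by_cases h : j = i
      · subst h; simp
      · simp [h]
    have e : Matrix.single a b (1 : ℂ) x y =
        (Pi.single a 1 : κ → ℂ) x * (Pi.single b 1 : κ → ℂ) y := by
      simp only [Matrix.single_apply, Pi.single_apply, eq_comm (a := a), eq_comm (a := b)]
      split_ifs <;> simp_all
    rw [e]
    simp only [v, Matrix.smul_apply, Matrix.add_apply, Matrix.vecMulVec_apply, Pi.star_apply,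
      Pi.add_apply, Pi.smul_apply, smul_eq_mul, star_add, star_mul', hs, star_neg, star_one,
      Complex.star_def, Complex.conj_I]
    linear_combination ((-1 / 2 : ℂ) * (Pi.single b 1 : κ → ℂ) x * (Pi.single a 1 : κ → ℂ) y
      + (1 / 2 : ℂ) * (Pi.single a 1 : κ → ℂ) x * (Pi.single b 1 : κ → ℂ) y) * Complex.I_sq
  rw [key]
  exact Submodule.smul_mem _ _ (add_mem (add_mem (add_mem (hv _) (Submodule.smul_mem _ _ (hv _)))
    (Submodule.smul_mem _ _ (hv _))) (Submodule.smul_mem _ _ (hv _)))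

theorem tensorPow_smul (c : ℂ) (X : Matrix κ κ ℂ) :
    tensorPow n (c • X) = c ^ n • tensorPow n X := by
  ext x y
  simp [tensorPow, Finset.prod_mul_distrib]

theorem tensorPow_apply_ne_zero_iff (X : Matrix κ κ ℂ) (x y : Fin n → κ) :
    tensorPow n X x y ≠ 0 ↔ ∀ i, X (x i) (y i) ≠ 0 := by
  simp [tensorPow, Finset.prod_eq_zero_iff]

theorem tensorPow_commute_totalNumberOp (num : κ → ℕ) {X : Matrix κ κ ℂ}
    (hX : ∀ a b, X a b ≠ 0 → num a = num b) :
    Commute (tensorPow n X) (totalNumberOp n num) := by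
  rw [totalNumberOp_eq_diagonal]
  refine ((commute_diagonal_iff _ _).2 fun x y h => ?_).symm
  refine Finset.sum_congr rfl fun i _ => hX _ _ ((tensorPow_apply_ne_zero_iff X x y).1 h i)

theorem tensorPow_mem_span_physicalIidStates (hn : n ≠ 0) (num : κ → ℕ) {ρ : Matrix κ κ ℂ}
    (hρ : ρ ∈ posNumberOps num) :
    tensorPow n ρ ∈ Submodule.span ℂ (physicalIidStates n num) := by
  -- Normalization fails only for `ρ = 0`, whose tensor power vanishes because `n ≠ 0`.
  by_cases ht : ρ.trace = 0
  · have h0 : tensorPow n ρ = 0 := by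
      rw [hρ.1.trace_eq_zero_iff.1 ht, ← zero_smul ℂ (0 : Matrix κ κ ℂ), tensorPow_smul,
        zero_pow hn, zero_smul]
    rw [h0]
    exact Submodule.zero_mem _
  · have h1 : ρ = ρ.trace • (ρ.trace⁻¹ • ρ) := by rw [smul_smul, mul_inv_cancel₀ ht, one_smul]
    rw [h1, tensorPow_smul]
    refine Submodule.smul_mem _ _ (Submodule.subset_span ⟨⟨_, ⟨?_, ?_⟩, rfl⟩, ?_⟩)
    · exact hρ.1.smul (inv_nonneg.2 hρ.1.trace_nonneg)
    · rw [Matrix.trace_smul, smul_eq_mul, inv_mul_cancel₀ ht]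
    · refine tensorPow_commute_totalNumberOp num fun a b h => hρ.2 a b ?_
      exact (mul_ne_zero_iff.1 h).2

theorem symmOps_subset_span_physicalIidStates (hn : n ≠ 0) (num : κ → ℕ) :
    symmOps n num ⊆ (Submodule.span ℂ (physicalIidStates n num) : Set (Op n κ)) := by
  rintro X ⟨hX, hnum⟩
  refine mem_of_forall_symmProd_single_mem X hX fun x y hxy => ?_
  refine symmProd_mem (P := posNumberOps num) ⟨Matrix.PosSemidef.zero, by simp⟩ ?_
    (fun ρ => tensorPow_mem_span_physicalIidStates hn num) _
    fun i => single_mem_span_posNumberOps num (hnum x y hxy i)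
  rintro ρ ⟨h1, h2⟩ τ ⟨h3, h4⟩
  refine ⟨h1.add h3, fun a b h => ?_⟩
  by_cases h0 : ρ a b = 0
  · exact h4 a b (by simpa [h0] using h)
  · exact h2 a b h0

theorem physicalIidStates_subset_symmOps (num : κ → ℕ) :
    physicalIidStates n num ⊆ symmOps n num := by
  rintro _ ⟨⟨ρ, hρ, rfl⟩, hc⟩
  refine ⟨fun σ x y => Equiv.prod_comp σ fun i => ρ (x i) (y i), fun x y hxy i => ?_⟩
  -- Unit trace supplies a nonzero diagonal entry. Putting `c` on every site but `i` makes the other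
  -- contributions to the total number equal, so its conservation isolates site `i`.
  obtain ⟨c, hcc⟩ : ∃ c, ρ c c ≠ 0 := by
    by_contra! h
    have := hρ.2
    simp [Matrix.trace, h] at this
  rw [totalNumberOp_eq_diagonal] at hc
  have h := (commute_diagonal_iff _ _).1 hc.eq.symm (Function.update (fun _ => c) i (x i))
    (Function.update (fun _ => c) i (y i)) ?_
  · rw [← Finset.add_sum_erase _ _ (Finset.mem_univ i),
      ← Finset.add_sum_erase _ _ (Finset.mem_univ i)] at h
    have e : ∀ a : κ, ∑ j ∈ Finset.univ.erase i,
        num (Function.update (fun _ => c) i a j) = ∑ j ∈ Finset.univ.erase i, num c := fun a =>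
      Finset.sum_congr rfl fun j hj => by rw [Function.update_of_ne (Finset.ne_of_mem_erase hj)]
    rw [e, e] at h
    simpa using h
  · refine (tensorPow_apply_ne_zero_iff _ _ _).2 fun j => ?_
    by_cases hj : j = i
    · subst hj
      simpa using (tensorPow_apply_ne_zero_iff ρ x y).1 hxy j
    · simpa [hj] using hcc

theorem bComNumber_eq_centralizer_symmOps (num : κ → ℕ) :
    bComNumber n num = Set.centralizer (symmOps n num) := by
  refine Set.Subset.antisymm ?_
    (Set.centralizer_subset (physicalIidStates_subset_symmOps num))
  intro Z hZ X hX
  -- For `n = 0` the operators are scalars and commute. The spanning lemma can fail here: with `κ`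
  -- empty there is no density matrix.
  by_cases hn : n = 0
  · subst hn
    ext x y
    simp [Matrix.mul_apply, Subsingleton.elim _ y, mul_comm]
  · have := symmOps_subset_span_physicalIidStates hn num hX
    clear hX
    induction this using Submodule.span_induction with
    | mem R hR => exact hZ R hR
    | zero => simp
    | add X Y _ _ ihX ihY => rw [add_mul, mul_add, ihX, ihY]
    | smul c X _ ih => rw [smul_mul_assoc, mul_smul_comm, ih]

/-- When every basis state has zero particles, the superselection rule is vacuous. -/
theorem bCom_eq_bComNumber_zero : bCom n κ = bComNumber n fun _ : κ => 0 := by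
  have : physicalIidStates n (fun _ : κ => 0) = iidStates n κ := by
    ext R
    refine and_iff_left_of_imp ?_
    rintro ⟨ρ, -, rfl⟩
    exact tensorPow_commute_totalNumberOp _ fun _ _ _ => rfl
  rw [bCom, bComNumber, this]

/-! ### The group of permutation operators -/

theorem permOp_one : permOp (κ := κ) (1 : Equiv.Perm (Fin n)) = 1 := by
  ext x y
  simp only [permOp, Matrix.of_apply, Matrix.one_apply]
  rfl

theorem permOp_mul (σ τ : Equiv.Perm (Fin n)) :
    permOp (κ := κ) (σ * τ) = permOp σ * permOp τ := by
  ext x y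
  simp only [permOp, Matrix.mul_apply, Matrix.of_apply]
  rw [Finset.sum_eq_single (y ∘ τ.symm) (fun z _ hz => by rw [if_neg hz, mul_zero]) (by simp),
    if_pos rfl, mul_one]
  rfl

theorem permOp_conjTranspose (σ : Equiv.Perm (Fin n)) :
    (permOp (κ := κ) σ)ᴴ = permOp σ⁻¹ := by
  have h1 : star (permOp (κ := κ) σ) * permOp σ = 1 :=
    Matrix.mem_unitaryGroup_iff'.1 (permOp_unitary σ)
  have h2 : permOp (κ := κ) σ * permOp σ⁻¹ = 1 := by
    rw [← permOp_mul, mul_inv_cancel, permOp_one]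
  exact left_inv_eq_right_inv h1 h2

theorem adjoin_range_permOp :
    (Algebra.adjoin ℂ (Set.range (permOp (κ := κ) (n := n))) : Set (Op n κ)) =
      Submodule.span ℂ (Set.range (permOp (κ := κ) (n := n))) := by
  let f : Equiv.Perm (Fin n) →* Op n κ := ⟨⟨permOp, permOp_one⟩, permOp_mul⟩
  have h : Submonoid.closure (Set.range (permOp (κ := κ) (n := n))) = MonoidHom.mrange f :=
    Submonoid.closure_eq (MonoidHom.mrange f)
  rw [← Subalgebra.coe_toSubmodule, Algebra.adjoin_eq_span, h]
  rfl

end Commutants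

end LatticeIID

theorem lemma4 {κ : Type*} [Fintype κ] [DecidableEq κ] (n : ℕ) :
    -- spin systems and massless boson systems
    (LatticeIID.bCom n κ =
        Set.centralizer (Set.centralizer (Set.range (LatticeIID.permOp (κ := κ) (n := n)))) ∧
      LatticeIID.bCom n κ =
        (Submodule.span ℂ (Set.range (LatticeIID.permOp (κ := κ) (n := n))) :
          Set (LatticeIID.Op n κ))) ∧
    -- massive boson systems with the number-superselection rule
    (∀ num : κ → ℕ, LatticeIID.bComNumber n num =
      Set.centralizer (Set.centralizer
        (Set.range (LatticeIID.permOp (κ := κ) (n := n)) ∪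
          Set.range (LatticeIID.numberOp (n := n) num)))) ∧
    -- massive fermion systems with the number-superselection rule
    (∀ num : κ → ℕ, LatticeIID.bComNumber n num =
      Set.centralizer (Set.centralizer
        (Set.range (LatticeIID.fermiPermOp (n := n) num) ∪
          Set.range (LatticeIID.numberOp (n := n) num)))) ∧
    -- double commutants are the generated von Neumann algebras
    (∀ A : Set (LatticeIID.Op n κ), 1 ∈ A → (∀ X ∈ A, Xᴴ ∈ A) →
      IsLeast {M | LatticeIID.IsVonNeumannAlgebra M ∧ A ⊆ M}
        (Set.centralizer (Set.centralizer A)) ∧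
      Set.centralizer (Set.centralizer A) =
        (Algebra.adjoin ℂ A : Set (LatticeIID.Op n κ))) := by
  have h1 : LatticeIID.bCom n κ =
      Set.centralizer (Set.centralizer (Set.range (LatticeIID.permOp (κ := κ) (n := n)))) := by
    rw [LatticeIID.bCom_eq_bComNumber_zero, LatticeIID.bComNumber_eq_centralizer_symmOps,
      LatticeIID.centralizer_permOp]
  refine ⟨⟨h1, ?_⟩, fun num => ?_, fun num => ?_, fun A _ hA => ⟨?_, ?_⟩⟩
  · rw [h1, LatticeIID.centralizer_centralizer_eq_adjoin, LatticeIID.adjoin_range_permOp]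
    rintro _ ⟨σ, rfl⟩
    exact ⟨σ⁻¹, (LatticeIID.permOp_conjTranspose σ).symm⟩
  · rw [LatticeIID.bComNumber_eq_centralizer_symmOps,
      LatticeIID.centralizer_permOp_union_numberOp]
  · rw [LatticeIID.bComNumber_eq_centralizer_symmOps,
      LatticeIID.centralizer_fermiPermOp_union_numberOp]
  · exact LatticeIID.isLeast_centralizer_centralizer hA
  · exact LatticeIID.centralizer_centralizer_eq_adjoin hA
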